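/- Let $k$ be a field (of arbitrary characteristic), let $B=k[x_1,x_2,x_3]$ be the polynomial ring in three variables over $k$, and let $f_1,f_2,f_3\in B$ satisfy $$f_i(f_1,f_2,f_3)=f_i\qquad (i=1,2,3).$$ (Equivalently, the $k$-algebra endomorphism of $B$ sending $x_i$ to $f_i$ for $i=1,2,3$ is idempotent, so that its image $A=k[f_1,f_2,f_3]$ is a retract of $B$.) Let $A=k[f_1,f_2,f_3]$ be the $k$-subalgebra of $B$ generated by $f_1,f_2,f_3$. Assume that $A\neq k$ and that at least one of $f_1,f_2,f_3$ is a monomial, i.e. of the form $c\,x_1^{p}x_2^{q}x_3^{r}$ with $c\in k\setminus\{0\}$ and $p,q,r\in\mathbb{Z}_{\geq 0}$. Then $A$ is a polynomial ring over $k$: there is an integer $n\geq 0$ such that $A\cong k[t_1,\dots,t_n]$ as $k$-algebras. -/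

import Mathlib

open MvPolynomial

section Retract

variable {R σ : Type*} [CommRing R]

/-! Let φ be the substitution. A monomial `f i = c x^m` satisfies `f i = c ∏ (f j)^(m j)`, and
unique factorization then forces some `f j` to be constant or equal to `X j`. So the image is a
retract of a polynomial ring in two variables over `k` or over `k[X j]`. Over a factorial `R`, such
a retract is everything if φ is injective; otherwise any two of its elements are dependent, and the
image of a suitable prime generates it. -/

/-- A nonzero element of a domain that is algebraically dependent on `a` divides a nonzero
polynomial expression in `a`. -/
theorem exists_dvd_aeval_of_not_algebraicIndependent {B : Type*} [CommRing B] [IsDomain B]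
    [Algebra R B] {x a : B} (hx : x ≠ 0)
    (h : ¬ AlgebraicIndependent R (fun o : Option Unit ↦ o.elim x fun _ ↦ a)) :
    ∃ q : Polynomial R, q ≠ 0 ∧ x ∣ Polynomial.aeval a q := by
  by_cases ha : Transcendental R a
  · have hi : AlgebraicIndependent R (fun _ : Unit ↦ a) :=
      algebraicIndependent_unique_type_iff.2 ha
    rw [hi.option_iff_transcendental, Transcendental, not_not] at h
    obtain ⟨⟨r, hr⟩, hr0, hd⟩ := h.exists_nonzero_dvd (mem_nonZeroDivisors_of_ne_zero hx)
    rw [Set.range_const, Algebra.adjoin_singleton_eq_range_aeval] at hr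
    obtain ⟨q, rfl⟩ := hr
    refine ⟨q, ?_, hd⟩
    rintro rfl
    exact hr0 (Subtype.ext (map_zero _))
  · rw [Transcendental, not_not] at ha
    obtain ⟨q, hq, hqa⟩ := ha
    exact ⟨q, hq, hqa ▸ dvd_zero x⟩

/-- Otherwise `v` is a transcendence basis, so a nonzero kernel element divides some nonzero `r` in
the range, giving `r = φ r = 0`. -/
theorem not_algebraicIndependent_of_retraction_not_injective [IsDomain R] [Fintype σ] {ι : Type*} [Fintype ι]
    (hcard : Fintype.card σ = Fintype.card ι)
    {φ : MvPolynomial σ R →ₐ[R] MvPolynomial σ R} (hφ : ∀ b, φ (φ b) = φ b)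
    (hinj : ¬ Function.Injective φ) {v : ι → MvPolynomial σ R} (hv : ∀ i, v i ∈ φ.range) :
    ¬ AlgebraicIndependent R v := by
  intro hi
  have ht : IsTranscendenceBasis R v := by
    apply hi.isTranscendenceBasis_of_lift_trdeg_le_of_finite
    rw [MvPolynomial.trdeg_of_isDomain]
    simp [hcard]
  have := ht.isAlgebraic
  rw [injective_iff_map_eq_zero] at hinj
  push Not at hinj
  obtain ⟨b, hb, hb0⟩ := hinj
  obtain ⟨⟨r, hr⟩, hr0, hd⟩ := (Algebra.IsAlgebraic.isAlgebraic
    (R := Algebra.adjoin R (Set.range v)) b).exists_nonzero_dvd (mem_nonZeroDivisors_of_ne_zero hb0)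
  have hr' : r ∈ φ.range := Algebra.adjoin_le (S := φ.range) (by rintro _ ⟨i, rfl⟩; exact hv i) hr
  obtain ⟨c, hc⟩ := hr'
  have h1 : φ b ∣ φ r := map_dvd φ hd
  rw [hb, zero_dvd_iff, ← hc] at h1
  apply hr0
  apply Subtype.ext
  change r = 0
  rw [← hc]
  exact (hφ c).symm.trans h1

/-- If the range of a retraction of `R[σ]` contains an element `s` without constant term dividing,
within the range, every element without constant term, then the range is generated by `s`. -/
theorem range_le_adjoin_of_dvd [IsDomain R] {φ : MvPolynomial σ R →ₐ[R] MvPolynomial σ R}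
    {s : MvPolynomial σ R} (hs0 : s ≠ 0) (hsc : constantCoeff s = 0)
    (hdvd : ∀ a ∈ φ.range, constantCoeff a = 0 → ∃ c ∈ φ.range, a = s * c) :
    φ.range ≤ Algebra.adjoin R {s} := by
  have hdeg : 0 < s.totalDegree := by
    rw [Nat.pos_iff_ne_zero, Ne, totalDegree_eq_zero_iff_eq_C]
    intro h
    apply hs0
    rw [h]
    change coeff 0 s = 0 at hsc
    rw [hsc, C_0]
  suffices ∀ n : ℕ, ∀ a ∈ φ.range, a.totalDegree < n → a ∈ Algebra.adjoin R {s} from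
    fun a ha ↦ this _ a ha (Nat.lt_succ_self _)
  intro n
  induction n with
  | zero => exact fun a _ h ↦ absurd h (Nat.not_lt_zero _)
  | succ n ih =>
    intro a ha hn
    have hC : C (constantCoeff a) ∈ φ.range := Subalgebra.algebraMap_mem φ.range _
    obtain ⟨c, hc, hac⟩ := hdvd (a - C (constantCoeff a)) (sub_mem ha hC) (by simp)
    rw [sub_eq_iff_eq_add] at hac
    have hmem : c ∈ Algebra.adjoin R {s} := by
      by_cases hc0 : c = 0
      · rw [hc0]; exact zero_mem _
      · apply ih c hc
        have h1 : (s * c).totalDegree ≤ a.totalDegree := by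
          rw [← sub_eq_iff_eq_add] at hac
          rw [← hac]
          exact totalDegree_sub_C_le _ _
        rw [totalDegree_mul_of_isDomain hs0 hc0] at h1
        omega
    rw [hac]
    exact add_mem (mul_mem (Algebra.self_mem_adjoin_singleton R s) hmem)
      (Subalgebra.algebraMap_mem _ _)

theorem exists_X_pow_mul_of_ne_zero {q : Polynomial R} (hq : q ≠ 0) :
    ∃ (n : ℕ) (p : Polynomial R), q = Polynomial.X ^ n * p ∧ p.coeff 0 ≠ 0 := by
  obtain ⟨p, hp, hnd⟩ := q.exists_eq_pow_rootMultiplicity_mul_and_not_dvd hq 0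
  rw [Polynomial.C_0, sub_zero] at hp hnd
  exact ⟨_, p, hp, fun h ↦ hnd (Polynomial.X_dvd_iff.2 h)⟩

theorem constantCoeff_aeval_of_constantCoeff_eq_zero {a : MvPolynomial σ R}
    (ha : constantCoeff a = 0) (p : Polynomial R) :
    constantCoeff (Polynomial.aeval a p) = p.coeff 0 := by
  rw [Polynomial.aeval_def, Polynomial.hom_eval₂, ha, Polynomial.eval₂_at_zero]
  simp

theorem transcendental_of_constantCoeff_eq_zero [IsDomain R] {s : MvPolynomial σ R} (hs0 : s ≠ 0)
    (hsc : constantCoeff s = 0) : Transcendental R s := by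
  rintro ⟨q, hq, hqs⟩
  obtain ⟨n, p, rfl, hp⟩ := exists_X_pow_mul_of_ne_zero hq
  rw [map_mul, map_pow, Polynomial.aeval_X, mul_eq_zero] at hqs
  have h := hqs.resolve_left (pow_ne_zero _ hs0)
  apply hp
  rw [← constantCoeff_aeval_of_constantCoeff_eq_zero hsc, h, map_zero]

/-- A retract of `R[σ]` over a factorial domain `R` in which any two elements are algebraically
dependent is `R` or a polynomial ring in one variable over `R`. -/
theorem range_eq_bot_or_exists_range_eq_adjoin [IsDomain R] [UniqueFactorizationMonoid R]
    {φ : MvPolynomial σ R →ₐ[R] MvPolynomial σ R} (hφ : ∀ b, φ (φ b) = φ b)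
    (hdep : ∀ x ∈ φ.range, ∀ a ∈ φ.range,
      ¬ AlgebraicIndependent R (fun o : Option Unit ↦ o.elim x fun _ ↦ a)) :
    φ.range = ⊥ ∨ ∃ s, Transcendental R s ∧ φ.range = Algebra.adjoin R {s} := by
  have hfix : ∀ a ∈ φ.range, φ a = a := by rintro _ ⟨b, rfl⟩; exact hφ b
  by_cases hbot : φ.range ≤ ⊥
  · exact Or.inl (le_bot_iff.1 hbot)
  right
  obtain ⟨y, hy, hyb⟩ := SetLike.not_le_iff_exists.1 hbot
  have hC : C (constantCoeff y) ∈ φ.range := Subalgebra.algebraMap_mem φ.range _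
  obtain ⟨x, hx, hx0, hxc⟩ : ∃ x ∈ φ.range, x ≠ 0 ∧ constantCoeff x = 0 := by
    refine ⟨y - C (constantCoeff y), sub_mem hy hC, ?_, by simp⟩
    intro h
    rw [sub_eq_zero] at h
    exact hyb (h ▸ Subalgebra.algebraMap_mem ⊥ (constantCoeff y))
  obtain ⟨F, hF, hFx⟩ := UniqueFactorizationMonoid.exists_prime_factors x hx0
  -- As `φ x = x` has no constant term, the same holds for the image of some prime factor; that
  -- image is the generator.
  obtain ⟨b, hb, hbc⟩ : ∃ b ∈ F, constantCoeff (φ b) = 0 := by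
    obtain ⟨u, hu⟩ := hFx.symm
    have h : ((constantCoeff (σ := σ) (R := R)).comp φ.toRingHom) F.prod = 0 := by
      rw [← hu]
      change constantCoeff (φ (x * u)) = 0
      rw [map_mul, hfix x hx, map_mul, hxc, zero_mul]
    rw [map_multiset_prod, Multiset.prod_eq_zero_iff, Multiset.mem_map] at h
    exact h
  have hbp := hF b hb
  have hbx : b ∣ x := (Multiset.dvd_prod hb).trans hFx.dvd
  have hs0 : φ b ≠ 0 := by
    intro h
    have := map_dvd φ hbx
    rw [h, zero_dvd_iff, hfix x hx] at this
    exact hx0 this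
  refine ⟨φ b, transcendental_of_constantCoeff_eq_zero hs0 hbc, le_antisymm
    (range_le_adjoin_of_dvd hs0 hbc ?_) ?_⟩
  · intro a ha hac
    obtain ⟨q, hq, hd⟩ := exists_dvd_aeval_of_not_algebraicIndependent hx0 (hdep x hx a ha)
    obtain ⟨n, p, rfl, hp⟩ := exists_X_pow_mul_of_ne_zero hq
    rw [map_mul, map_pow, Polynomial.aeval_X] at hd
    -- If `b` divided `p(a)`, applying φ and taking constant terms would give `p(0) = 0`.
    have hba : b ∣ a := by
      rcases hbp.dvd_or_dvd (hbx.trans hd) with h | h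
      · exact hbp.dvd_of_dvd_pow h
      · exfalso
        have h1 := map_dvd constantCoeff (map_dvd φ h)
        rw [hbc, zero_dvd_iff, ← Polynomial.aeval_algHom_apply, hfix a ha,
          constantCoeff_aeval_of_constantCoeff_eq_zero hac] at h1
        exact hp h1
    obtain ⟨c, hc⟩ := hba
    refine ⟨φ c, ⟨c, rfl⟩, ?_⟩
    rw [← hfix a ha, hc, map_mul]
  · rw [Algebra.adjoin_le_iff, Set.singleton_subset_iff]
    exact ⟨b, rfl⟩

/-- Retracts of a polynomial ring in two variables over a factorial domain are polynomial rings. -/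
theorem exists_range_algEquiv_mvPolynomial [IsDomain R] [UniqueFactorizationMonoid R]
    {φ : MvPolynomial (Fin 2) R →ₐ[R] MvPolynomial (Fin 2) R} (hφ : ∀ b, φ (φ b) = φ b) :
    ∃ r : ℕ, Nonempty (φ.range ≃ₐ[R] MvPolynomial (Fin r) R) := by
  by_cases hinj : Function.Injective φ
  · exact ⟨2, ⟨(AlgEquiv.ofInjective φ hinj).symm⟩⟩
  rcases range_eq_bot_or_exists_range_eq_adjoin hφ (fun x hx a ha ↦
    not_algebraicIndependent_of_retraction_not_injective (by simp) hφ hinj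
      (by rintro (_ | _) <;> assumption)) with h | ⟨s, hs, h⟩
  · rw [h]
    refine ⟨0, ⟨(Algebra.botEquivOfInjective ?_).trans (isEmptyAlgEquiv R (Fin 0)).symm⟩⟩
    exact C_injective (Fin 2) R
  · rw [h, Algebra.adjoin_singleton_eq_range_aeval]
    exact ⟨1, ⟨(AlgEquiv.ofInjective _ (transcendental_iff_injective.1 hs)).symm.trans
      (uniqueAlgEquiv R (Fin 1)).symm⟩⟩

end Retract

section Transfer

variable {k B B' : Type*} [CommRing k] [CommRing B] [Algebra k B] [CommRing B'] [Algebra k B']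

theorem comp_comp_idempotent {φ : B →ₐ[k] B} (hφ : ∀ b, φ (φ b) = φ b) {ι : B' →ₐ[k] B}
    {π : B →ₐ[k] B'} (h : ∀ b, φ (ι (π b)) = φ b) (b : B') :
    (π.comp (φ.comp ι)) ((π.comp (φ.comp ι)) b) = (π.comp (φ.comp ι)) b := by
  simp [h, hφ]

/-- On the range of φ, `π` has left inverse `φ ∘ ι`. -/
theorem nonempty_range_algEquiv_comp_comp {φ : B →ₐ[k] B} (hφ : ∀ b, φ (φ b) = φ b)
    {ι : B' →ₐ[k] B} {π : B →ₐ[k] B'} (h : ∀ b, φ (ι (π b)) = φ b) :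
    Nonempty (φ.range ≃ₐ[k] (π.comp (φ.comp ι)).range) := by
  have hr : (π.comp φ.range.val).range = (π.comp (φ.comp ι)).range := by
    apply le_antisymm
    · rintro _ ⟨⟨_, b, rfl⟩, rfl⟩
      exact ⟨π b, congrArg π (h b)⟩
    · rintro _ ⟨b, rfl⟩
      exact ⟨⟨_, ι b, rfl⟩, rfl⟩
  rw [← hr]
  refine ⟨AlgEquiv.ofInjective _ ?_⟩
  rintro ⟨_, a, rfl⟩ ⟨_, b, rfl⟩ hab
  apply Subtype.ext
  have h1 : φ (ι (π (φ a))) = φ (ι (π (φ b))) :=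
    congrArg (fun x ↦ φ (ι x)) (show π (φ a) = π (φ b) from hab)
  rw [h, h, hφ, hφ] at h1
  exact h1

end Transfer

section Three

variable {k : Type*} [Field k]

theorem exists_range_algEquiv_of_apply_X_eq_C
    {φ : MvPolynomial (Fin 3) k →ₐ[k] MvPolynomial (Fin 3) k} (hφ : ∀ b, φ (φ b) = φ b)
    {i : Fin 3} {c : k} (hi : φ (X i) = C c) :
    ∃ r : ℕ, Nonempty (φ.range ≃ₐ[k] MvPolynomial (Fin r) k) := by
  let ι : MvPolynomial (Fin 2) k →ₐ[k] MvPolynomial (Fin 3) k := rename i.succAbove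
  let π : MvPolynomial (Fin 3) k →ₐ[k] MvPolynomial (Fin 2) k :=
    aeval (i.insertNth (α := fun _ ↦ MvPolynomial (Fin 2) k) (C c) X)
  have h : ∀ b, φ (ι (π b)) = φ b := by
    suffices φ.comp (ι.comp π) = φ from fun b ↦ DFunLike.congr_fun this b
    refine algHom_ext fun j ↦ ?_
    refine Fin.succAboveCases i ?_ (fun j ↦ ?_) j
    · simp [π, ι, hi]
    · simp [π, ι]
  obtain ⟨e⟩ := nonempty_range_algEquiv_comp_comp hφ h
  obtain ⟨r, ⟨e'⟩⟩ := exists_range_algEquiv_mvPolynomial (comp_comp_idempotent hφ h)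
  exact ⟨r, ⟨e.trans e'⟩⟩

theorem exists_range_algEquiv_of_apply_X_eq_X
    {φ : MvPolynomial (Fin 3) k →ₐ[k] MvPolynomial (Fin 3) k} (hφ : ∀ b, φ (φ b) = φ b)
    {i : Fin 3} (hi : φ (X i) = X i) :
    ∃ r : ℕ, Nonempty (φ.range ≃ₐ[k] MvPolynomial (Fin r) k) := by
  let e : MvPolynomial (Fin 3) k ≃ₐ[k] MvPolynomial (Fin 2) (Polynomial k) :=
    (renameEquiv k (finSuccEquiv' i)).trans (optionEquivRight k (Fin 2))
  have he : e (X i) = C Polynomial.X := by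
    simp [e]
  have h : ∀ b, φ (e.symm.toAlgHom (e.toAlgHom b)) = φ b := by simp
  obtain ⟨e₁⟩ := nonempty_range_algEquiv_comp_comp hφ h
  have hid := comp_comp_idempotent hφ h
  set ψ := e.toAlgHom.comp (φ.comp e.symm.toAlgHom) with hψ
  have hX : ψ (C Polynomial.X) = C Polynomial.X := by
    rw [← he]
    simp [hψ, hi]
  -- Fixing the variable makes the retraction `k[X i]`-linear.
  have hC : ∀ p : Polynomial k, ψ (C p) = C p := by
    intro p
    have : ψ.comp (Algebra.ofId (Polynomial k) _ |>.restrictScalars k) =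
        (Algebra.ofId (Polynomial k) (MvPolynomial (Fin 2) (Polynomial k))).restrictScalars k :=
      Polynomial.algHom_ext hX
    exact DFunLike.congr_fun this p
  let ψ' : MvPolynomial (Fin 2) (Polynomial k) →ₐ[Polynomial k]
      MvPolynomial (Fin 2) (Polynomial k) := { ψ with commutes' := hC }
  obtain ⟨r, ⟨e₂⟩⟩ := exists_range_algEquiv_mvPolynomial (φ := ψ') hid
  have hr : ψ.range = ψ'.range.restrictScalars k := rfl
  exact ⟨r + 1, ⟨e₁.trans <| (Subalgebra.equivOfEq _ _ hr).trans <|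
    (e₂.restrictScalars k).trans <| (optionEquivRight k (Fin r)).symm.trans <|
      renameEquiv k (finSuccEquiv r).symm⟩⟩

end Three

section Monomial

variable {k σ : Type*} [Field k] [Fintype σ]

theorem eq_mul_prod_pow_of_eq_monomial {f : σ → MvPolynomial σ k} (hf : ∀ i, aeval f (f i) = f i)
    {i : σ} {m : σ →₀ ℕ} {c : k} (hm : f i = monomial m c) : f i = C c * ∏ j, f j ^ m j := by
  rw [← hf i]
  nth_rw 1 [hm]
  rw [aeval_monomial, Finsupp.prod_fintype _ _ (by simp)]
  rfl

theorem exists_eq_C_or_eq_X_of_exponent_ne_zero {f : σ → MvPolynomial σ k}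
    (hf : ∀ i, aeval f (f i) = f i) {i : σ} {m : σ →₀ ℕ} {c : k} (hc : c ≠ 0)
    (hm : f i = monomial m c) (hi : m i ≠ 0) : ∃ j, (∃ d, f j = C d) ∨ f j = X j := by
  classical
  have hfi : f i ≠ 0 := by rw [hm]; simpa using hc
  have hunit : ∀ j, IsUnit (f j) → ∃ d, f j = C d := fun j hj ↦ by
    obtain ⟨d, -, hd⟩ := isUnit_iff_eq_C_of_isReduced.1 hj
    exact ⟨d, hd⟩
  obtain ⟨n, hn⟩ := Nat.exists_eq_succ_of_ne_zero hi
  -- Cancelling one `f i` makes every remaining factor a unit, hence constant; if none remains, `f i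
  -- = X i`.
  have hprod : 1 = f i ^ n * (C c * ∏ j ∈ Finset.univ.erase i, f j ^ m j) := by
    apply mul_left_cancel₀ hfi
    rw [mul_one]
    nth_rw 1 [eq_mul_prod_pow_of_eq_monomial hf hm]
    rw [← Finset.mul_prod_erase _ _ (Finset.mem_univ i), hn, pow_succ]
    ring
  by_cases hn0 : n = 0
  · by_cases hex : ∃ j, j ≠ i ∧ m j ≠ 0
    · obtain ⟨j, hji, hj⟩ := hex
      refine ⟨j, Or.inl (hunit j (isUnit_of_dvd_one ?_))⟩
      rw [hprod]
      exact (((dvd_pow_self _ hj).trans (Finset.dvd_prod_of_mem (fun j ↦ f j ^ m j)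
        (Finset.mem_erase.2 ⟨hji, Finset.mem_univ j⟩))).mul_left _).mul_left _
    · push Not at hex
      refine ⟨i, Or.inr ?_⟩
      rw [hn0, pow_zero, one_mul, Finset.prod_eq_one, mul_one] at hprod
      · have hc1 : c = 1 := (C_injective σ k (by rw [C_1]; exact hprod)).symm
        rw [hm, hc1, X]
        have hmi : m = Finsupp.single i 1 := by
          ext j
          by_cases hj : j = i
          · subst hj; simp [hn, hn0]
          · simp [hex j hj, hj]
        rw [hmi]
      · intro j hj
        rw [hex j (Finset.ne_of_mem_erase hj), pow_zero]
  · refine ⟨i, Or.inl (hunit i (isUnit_of_dvd_one ?_))⟩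
    rw [hprod]
    exact (dvd_pow_self _ hn0).mul_right _

/-- If an idempotent substitution sends some variable to a monomial, then it sends some variable
to a constant or fixes some variable. -/
theorem exists_eq_C_or_eq_X_of_eq_monomial {f : σ → MvPolynomial σ k}
    (hf : ∀ i, aeval f (f i) = f i) {i : σ} {m : σ →₀ ℕ} {c : k} (hc : c ≠ 0)
    (hm : f i = monomial m c) : ∃ j, (∃ d, f j = C d) ∨ f j = X j := by
  induction hN : m.support.card using Nat.strong_induction_on generalizing i m c with
  | _ N ih =>
    by_cases hi : m i = 0
    swap
    · exact exists_eq_C_or_eq_X_of_exponent_ne_zero hf hc hm hi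
    by_cases hm0 : m = 0
    · exact ⟨i, Or.inl ⟨c, by rw [hm, hm0]; rfl⟩⟩
    obtain ⟨j, hj⟩ := Finsupp.support_nonempty_iff.2 hm0
    have hdvd : f j ∣ monomial m c := by
      rw [← hm, eq_mul_prod_pow_of_eq_monomial hf hm]
      exact ((dvd_pow_self _ (Finsupp.mem_support_iff.1 hj)).trans
        (Finset.dvd_prod_of_mem (fun j ↦ f j ^ m j) (Finset.mem_univ j))).mul_left _
    obtain ⟨m', c', hle, hc', hm'⟩ := (dvd_monomial_iff_exists hc).1 hdvd
    have hc0 : c' ≠ 0 := fun h ↦ hc (zero_dvd_iff.1 (h ▸ hc'))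
    -- Here `f j` is a monomial with `m' ≤ m`; if `j` is missing from `m'`, the support has shrunk.
    by_cases hj' : m' j = 0
    · refine ih _ ?_ hc0 hm' rfl
      rw [← hN]
      refine Finset.card_lt_card ⟨Finsupp.support_mono hle, fun h ↦ ?_⟩
      exact Finsupp.mem_support_iff.1 (h hj) hj'
    · exact exists_eq_C_or_eq_X_of_exponent_ne_zero hf hc0 hm' hj'

end Monomial

theorem proposition4p4 {k : Type*} [Field k] (f : Fin 3 → MvPolynomial (Fin 3) k)
    (hf : ∀ i, MvPolynomial.aeval f (f i) = f i)
    (hA : Algebra.adjoin k (Set.range f) ≠ ⊥)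
    (hmon : ∃ (i : Fin 3) (m : Fin 3 →₀ ℕ) (c : k), c ≠ 0 ∧ f i = MvPolynomial.monomial m c) :
    ∃ r : ℕ, Nonempty (Algebra.adjoin k (Set.range f) ≃ₐ[k] MvPolynomial (Fin r) k) := by
  obtain ⟨i, m, c, hc, hm⟩ := hmon
  have hφ : ∀ b, aeval (R := k) f (aeval (R := k) f b) = aeval f b := by
    suffices (aeval (R := k) f).comp (aeval (R := k) f) = aeval f from fun b ↦ DFunLike.congr_fun this b
    exact algHom_ext fun j ↦ by simpa using hf j
  rw [Algebra.adjoin_range_eq_range_aeval]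
  obtain ⟨j, ⟨d, hj⟩ | hj⟩ := exists_eq_C_or_eq_X_of_eq_monomial hf hc hm
  · exact exists_range_algEquiv_of_apply_X_eq_C hφ (i := j) (c := d) (by rw [aeval_X, hj])
  · exact exists_range_algEquiv_of_apply_X_eq_X hφ (i := j) (by rw [aeval_X, hj])
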